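/- Let $k\ge 0$ be an integer. A binary Markov kernel of order $k$ is a family $P=(P_z)_{z\in\{0,1\}^k}$ of probability distributions on $\{0,1\}$. Let $P$ be random, with independent rows $P_z\sim\mathrm{Dir}(1)$, that is, uniformly distributed on the simplex of distributions on $\{0,1\}$. Given $P$, let $x_1,\dots,x_k$ be independent and uniform on $\{0,1\}$, and let $x_{t+1}\sim P_{x_{t-k+1}\cdots x_t}$ given $x_1,\dots,x_t$ for $t\ge k$. The order-$k$ add-1 estimator is, for $t\ge k$ and $a\in\{0,1\}$, $$\mathbb P_1^{(k)}(a\mid x_1^t)=\frac{n_a+1}{n+2},$$ where $n$ is the number of $i\in\{k+1,\dots,t\}$ with $(x_{i-k},\dots,x_{i-1})=(x_{t-k+1},\dots,x_t)$, and $n_a$ is the number of those $i$ that also satisfy $x_i=a$. Consider a recurrent model $H_t=h_t(H_{t-1},x_t)$, $y_t=g_t(H_t)$ for $t\ge1$, with a fixed initial state $H_0$, hidden states $H_t\in\mathbb R^d$, and outputs $y_t$ that are probability distributions on $\{0,1\}$. Suppose that it has $\mathtt p$ bits of precision: for each coordinate there is a fixed set of at most $2^{\mathtt p}$ real numbers that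 contains this coordinate of $H_t$ for all $t$ and all input sequences. Let $0<\varepsilon\le 1$ and suppose that, almost surely over $P$ and the sequence $(x_t)_{t\ge1}$, for all sufficiently large $t$, $$\bigl\|y_t-\mathbb P_1^{(k)}(\cdot\mid x_1^t)\bigr\|_\infty\le\varepsilon .$$ Then $$d\cdot\mathtt p\;\ge\;2^k\,(1-3\varepsilon)\,\ln(1/\varepsilon).$$ If moreover the model is time-invariant ($h_t=h$ and $g_t=g$ for all $t$), then also $$d\cdot\mathtt p\;\ge\;2^k\,(1-3\varepsilon)\,\log_2(1/\varepsilon).$$ In particular, for fixed $\varepsilon<1/3$ the state size $d\cdot\mathtt p$ must grow exponentially in the Markov order $k$. -/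

import Mathlib

open MeasureTheory ProbabilityTheory Filter

noncomputable section

namespace MarkovICL

/-- A probability distribution on the binary alphabet `{0, 1}`, as a vector of two weights. -/
abbrev BinDist : Type := stdSimplex ℝ (Fin 2)

/-- Transition probabilities of a binary Markov chain of order `k`: for each context
`i₁ … i_k` the law of the next symbol. -/
abbrev MarkovKernel (k : ℕ) : Type := (Fin k → Fin 2) → BinDist

/-- The length-`k` context that precedes position `t`. Sequences are indexed from `0`: `x 0, x 1, …`
are the first, second, … symbols, so that the first `t` symbols are `x 0, …, x (t - 1)` and this
context consists of the last `k` of them. It is meaningful for `k ≤ t`. -/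
def context (k : ℕ) (x : ℕ → Fin 2) (t : ℕ) : Fin k → Fin 2 :=
  fun j => x (t - k + j)

/-! ### The random Markov source -/

/-- The Dirichlet distribution with parameter `1` on the binary simplex, that is, the uniform
distribution on it: the law of `(1 - q, q)` for `q` uniform on `[0, 1]`. -/
def dirichletOne : Measure BinDist :=
  (volume : Measure unitInterval).map (stdSimplexHomeomorphUnitInterval.symm)

instance : IsProbabilityMeasure dirichletOne :=
  Measure.isProbabilityMeasure_map
    stdSimplexHomeomorphUnitInterval.symm.continuous.measurable.aemeasurable

/-- The prior on kernels: the rows are independent with law `dirichletOne`. -/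
def kernelPrior (k : ℕ) : Measure (MarkovKernel k) :=
  Measure.pi fun _ : Fin k → Fin 2 => dirichletOne

/-- A binary distribution, as a measure on the alphabet. -/
def letterMeasure (q : BinDist) : Measure (Fin 2) :=
  ∑ a : Fin 2, ENNReal.ofReal ((q : Fin 2 → ℝ) a) • Measure.dirac a

instance (q : BinDist) : IsProbabilityMeasure (letterMeasure q) := by
  constructor
  have h0 : 0 ≤ (q : Fin 2 → ℝ) 0 := q.2.1 0
  have h1 : 0 ≤ (q : Fin 2 → ℝ) 1 := q.2.1 1
  have h : (q : Fin 2 → ℝ) 0 + (q : Fin 2 → ℝ) 1 = 1 := by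
    rw [← Fin.sum_univ_two]; exact q.2.2
  simp only [letterMeasure, Fin.sum_univ_two, Measure.add_apply, Measure.smul_apply,
    measure_univ, smul_eq_mul, mul_one]
  rw [← ENNReal.ofReal_add h0 h1, h, ENNReal.ofReal_one]

/-- The law of the symbol that follows the first `t` symbols of `x`: uniform if `t < k`, and
given by the row of `P` of the current context otherwise. -/
def nextLaw {k : ℕ} (P : MarkovKernel k) (t : ℕ) (x : ℕ → Fin 2) : Measure (Fin 2) :=
  if k ≤ t then letterMeasure (P (context k x t)) else uniformOn Set.univ

instance {k : ℕ} (P : MarkovKernel k) (t : ℕ) (x : ℕ → Fin 2) :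
    IsProbabilityMeasure (nextLaw P t x) := by
  unfold nextLaw
  split_ifs
  · infer_instance
  · exact isProbabilityMeasure_uniformOn Set.finite_univ Set.univ_nonempty

/-- A finite history `x 0, …, x n`, continued by zeros. -/
def extendHistory {n : ℕ} (w : Finset.Iic n → Fin 2) : ℕ → Fin 2 :=
  fun i => if h : i ≤ n then w ⟨i, Finset.mem_Iic.2 h⟩ else 0

/-- The transition from the first `n + 1` symbols to the next one, as a probability kernel. -/
def stepKernel {k : ℕ} (P : MarkovKernel k) (n : ℕ) : Kernel (Finset.Iic n → Fin 2) (Fin 2) :=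
  Kernel.ofFunOfCountable fun w => nextLaw P (n + 1) (extendHistory w)

instance {k : ℕ} (P : MarkovKernel k) (n : ℕ) : IsMarkovKernel (stepKernel P n) :=
  ⟨fun w => inferInstanceAs (IsProbabilityMeasure (nextLaw P (n + 1) (extendHistory w)))⟩

/-- The law of an infinite sequence generated by the kernel `P`: the first `k` symbols are
independent and uniform, every later symbol is drawn from the row of `P` of its context. -/
def markovLaw {k : ℕ} (P : MarkovKernel k) : Measure (ℕ → Fin 2) :=
  Kernel.trajMeasure (X := fun _ => Fin 2) (nextLaw P 0 fun _ => 0) (stepKernel P)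

/-! ### The add-one estimator -/

/-- The number of positions among the first `t` symbols of `x` that are preceded by the
context `z`. -/
def contextCount (k : ℕ) (x : ℕ → Fin 2) (t : ℕ) (z : Fin k → Fin 2) : ℕ :=
  ((Finset.Ico k t).filter fun j => context k x j = z).card

/-- The number of positions among the first `t` symbols of `x` that are preceded by the
context `z` and carry the symbol `a`. -/
def transitionCount (k : ℕ) (x : ℕ → Fin 2) (t : ℕ) (z : Fin k → Fin 2) (a : Fin 2) : ℕ :=
  ((Finset.Ico k t).filter fun j => context k x j = z ∧ x j = a).card

/-- The add-one (Laplace) estimator of order `k` of the law of the symbol that follows the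
first `t` symbols of `x`. -/
def addOne (k : ℕ) (x : ℕ → Fin 2) (t : ℕ) : Fin 2 → ℝ := fun a =>
  ((transitionCount k x t (context k x t) a : ℝ) + 1) /
    ((contextCount k x t (context k x t) : ℝ) + 2)

/-! ### Recurrent models -/

/-- A recurrent model `H_t = h_t (H_{t-1}, x_t)`, `y_t = g_t (H_t)` with hidden states in `ℝ^d`,
whose outputs are distributions of the next symbol. -/
structure RecurrentModel (d : ℕ) where
  /-- the initial state `H_0` -/
  init : Fin d → ℝ
  /-- the transition maps `h_t` -/
  step : ℕ → (Fin d → ℝ) → Fin 2 → (Fin d → ℝ)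
  /-- the output maps `g_t` -/
  readout : ℕ → (Fin d → ℝ) → BinDist

namespace RecurrentModel

variable {d : ℕ} (M : RecurrentModel d)

/-- The hidden state `H_t` after the first `t` symbols of `x`. -/
def state (x : ℕ → Fin 2) : ℕ → (Fin d → ℝ)
  | 0 => M.init
  | t + 1 => M.step (t + 1) (state x t) (x t)

/-- The prediction `y_t` after the first `t` symbols of `x`. -/
def predict (x : ℕ → Fin 2) (t : ℕ) : BinDist :=
  M.readout t (M.state x t)

/-- The same maps `h` and `g` are used at all times. -/
def TimeInvariant : Prop :=
  (∀ s t, M.step s = M.step t) ∧ ∀ s t, M.readout s = M.readout t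

/-- Each coordinate of the hidden state is stored with `p` bits: it only takes values in a fixed
set of at most `2 ^ p` reals. -/
def HasBitPrecision (p : ℕ) : Prop :=
  ∃ F : Fin d → Finset ℝ, (∀ i, (F i).card ≤ 2 ^ p) ∧ ∀ x t i, M.state x t i ∈ F i

/-- Almost surely over the kernel `P` drawn from the prior and the sequence `x` generated by `P`,
the predictions are within `ε` of the add-one estimator of order `k` in the sup norm, for all
sufficiently large times. -/
def ApproximatesAddOne (k : ℕ) (ε : ℝ) : Prop :=
  ∀ᵐ P ∂kernelPrior k, ∀ᵐ x ∂markovLaw P, ∀ᶠ t in atTop,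
    ‖(M.predict x t : Fin 2 → ℝ) - addOne k x t‖ ≤ ε

end RecurrentModel

end MarkovICL

end

open MeasureTheory ProbabilityTheory Filter

noncomputable section

namespace MarkovICL

/-! ### Functions of finitely many symbols -/

section DependsOn

/-! The state at one time must locate the whole kernel. Almost every kernel has positive entries, so
a word of fixed length is spelled after any history with probability bounded below
(`pow_mul_integral_le_integral_ite_word`). The add-one estimator converges in probability to the
true row (`tendsto_measureReal_addOne`). Hence at late times some path follows a prescribed word
while every prediction is within `ε + δ` of the row in use (`eventually_exists_path`).

If the word visits all contexts, the state before it fixes all these predictions, so the `2 ^ k`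
parameters of the kernel lie in one of at most `2 ^ (d * p)` boxes of half-width `ε + δ`. These
boxes cover almost all of the unit cube, and `δ → 0` gives `1 ≤ 2 ^ (d * p) * (2 * ε) ^ 2 ^ k`. The
numerical inequality `one_sub_mul_log_le_logb` turns this into the first bound.

Time-invariant dynamics on finitely many states have a recurrent state. Steering back to it before
each test makes the predictions independent of the kernel, so a single box suffices and `1 / 2 ≤ ε`
(`half_le_of_timeInvariant`); the second bound is then trivial. -/

lemma exists_comp_restrict_of_dependsOn {β : Type*} {F : (ℕ → Fin 2) → β} {t : ℕ}
    (hF : DependsOn F (Set.Iio t)) :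
    ∃ g : (Finset.range t → Fin 2) → β, ∀ x, F x = g ((Finset.range t).restrict x) := by
  refine ⟨fun w => F fun i => if h : i ∈ Finset.range t then w ⟨i, h⟩ else 0, fun x => hF ?_⟩
  intro i hi
  have : i < t := hi
  simp [this]

/-- There are only finitely many prefixes of length `t`. `DependsOn` thus plays the role of
adaptedness to a filtration. -/
lemma measurable_of_dependsOn {β : Type*} [MeasurableSpace β] {F : (ℕ → Fin 2) → β} {t : ℕ}
    (hF : DependsOn F (Set.Iio t)) : Measurable F := by
  obtain ⟨g, hg⟩ := exists_comp_restrict_of_dependsOn hF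
  have : F = g ∘ (Finset.range t).restrict := funext hg
  rw [this]
  exact (measurable_of_finite g).comp (Finset.measurable_restrict _)

lemma measurableSet_of_dependsOn {p : (ℕ → Fin 2) → Prop} {t : ℕ}
    (hp : DependsOn p (Set.Iio t)) : MeasurableSet {x | p x} :=
  measurableSet_setOfPred.2 (measurable_of_dependsOn hp)

lemma integrable_of_dependsOn {F : (ℕ → Fin 2) → ℝ} {t : ℕ} (hF : DependsOn F (Set.Iio t))
    (μ : Measure (ℕ → Fin 2)) [IsFiniteMeasure μ] : Integrable F μ := by
  obtain ⟨g, hg⟩ := exists_comp_restrict_of_dependsOn hF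
  obtain ⟨C, hC⟩ := (Set.finite_range fun w => ‖g w‖).bddAbove
  refine Integrable.of_bound (measurable_of_dependsOn hF).aestronglyMeasurable C
    (ae_of_all _ fun x => ?_)
  rw [hg]
  exact hC ⟨_, rfl⟩

lemma dependsOn_Iio_mono {β : Type*} {F : (ℕ → Fin 2) → β} {s t : ℕ} (hst : s ≤ t)
    (hF : DependsOn F (Set.Iio s)) : DependsOn F (Set.Iio t) :=
  hF.mono (Set.Iio_subset_Iio hst)

lemma apply_update_of_dependsOn {β : Type*} {F : (ℕ → Fin 2) → β} {t : ℕ}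
    (hF : DependsOn F (Set.Iio t)) (x : ℕ → Fin 2) (a : Fin 2) :
    F (Function.update x t a) = F x :=
  hF fun _ hi => Function.update_of_ne (ne_of_lt hi) _ _

lemma context_congr {k t : ℕ} (h : k ≤ t) {x y : ℕ → Fin 2} (hxy : ∀ i < t, x i = y i) :
    context k x t = context k y t := by
  funext j
  exact hxy _ (by have := j.2; omega)

end DependsOn

/-! ### The transition probabilities -/

/-- The probability that the symbol at position `t` is `a`, given the earlier symbols of `x`. -/
def stepProb {k : ℕ} (P : MarkovKernel k) (t : ℕ) (x : ℕ → Fin 2) (a : Fin 2) : ℝ :=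
  if k ≤ t then (P (context k x t) : Fin 2 → ℝ) a else 1 / 2

section Markov

variable {k : ℕ} (P : MarkovKernel k)

lemma sum_binDist (q : BinDist) : (q : Fin 2 → ℝ) 0 + (q : Fin 2 → ℝ) 1 = 1 := by
  rw [← Fin.sum_univ_two]; exact q.2.2

lemma letterMeasure_real_singleton (q : BinDist) (a : Fin 2) :
    (letterMeasure q).real {a} = (q : Fin 2 → ℝ) a := by
  have h0 : 0 ≤ (q : Fin 2 → ℝ) 0 := q.2.1 0
  have h1 : 0 ≤ (q : Fin 2 → ℝ) 1 := q.2.1 1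
  fin_cases a <;> simp [letterMeasure, Measure.real, h0, h1]

lemma nextLaw_real_singleton (t : ℕ) (x : ℕ → Fin 2) (a : Fin 2) :
    (nextLaw P t x).real {a} = stepProb P t x a := by
  unfold nextLaw stepProb
  split_ifs
  · exact letterMeasure_real_singleton _ _
  · simp [Measure.real, uniformOn_univ]

lemma integral_nextLaw (t : ℕ) (x : ℕ → Fin 2) (f : Fin 2 → ℝ) :
    ∫ a, f a ∂nextLaw P t x = ∑ a, stepProb P t x a * f a := by
  rw [integral_fintype Integrable.of_finite]
  simp [nextLaw_real_singleton]

lemma stepProb_nonneg (t : ℕ) (x : ℕ → Fin 2) (a : Fin 2) : 0 ≤ stepProb P t x a := by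
  unfold stepProb
  split_ifs
  · exact (P _).2.1 a
  · norm_num

lemma sum_stepProb (t : ℕ) (x : ℕ → Fin 2) : ∑ a, stepProb P t x a = 1 := by
  unfold stepProb
  split_ifs
  · exact (P _).2.2
  · norm_num

lemma stepProb_congr {t : ℕ} {x y : ℕ → Fin 2} (hxy : ∀ i < t, x i = y i) :
    stepProb P t x = stepProb P t y := by
  funext a
  unfold stepProb
  split_ifs with h
  · rw [context_congr h hxy]
  · rfl

instance : IsProbabilityMeasure (markovLaw P) := by
  unfold markovLaw; infer_instance

lemma integral_markovLaw_zero (f : Fin 2 → ℝ) :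
    ∫ x, f (x 0) ∂markovLaw P = ∑ a, stepProb P 0 (fun _ => 0) a * f a := by
  rw [← integral_nextLaw]
  have hmap : (markovLaw P).map (fun x => x 0) = nextLaw P 0 fun _ => 0 := by
    have h0 : (markovLaw P).map (Preorder.frestrictLe (π := fun _ => Fin 2) 0)
        = (nextLaw P 0 fun _ => 0).map (MeasurableEquiv.piUnique _).symm := by
      unfold markovLaw Kernel.trajMeasure
      rw [Measure.map_comp _ _ (by fun_prop), Kernel.traj_map_frestrictLe, Kernel.partialTraj_self,
        Measure.id_comp]
    have h1 := congrArg (Measure.map fun w : Finset.Iic 0 → Fin 2 =>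
      w ⟨0, Finset.mem_Iic.2 le_rfl⟩) h0
    rw [Measure.map_map (measurable_pi_apply _) (by fun_prop),
      Measure.map_map (measurable_pi_apply _) (MeasurableEquiv.measurable _)] at h1
    refine h1.trans ?_
    exact Measure.map_id
  rw [← hmap, integral_map (measurable_pi_apply 0).aemeasurable
    (measurable_of_finite f).aestronglyMeasurable]

/-- One-step conditioning: the last relevant symbol is resampled from its conditional law. The later
estimates use the trajectory measure only through this identity and its total mass one. -/
lemma integral_markovLaw_eq_step {F : (ℕ → Fin 2) → ℝ} {t : ℕ}
    (hF : DependsOn F (Set.Iio (t + 1))) :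
    ∫ x, F x ∂markovLaw P
      = ∫ x, ∑ a, stepProb P t x a * F (Function.update x t a) ∂markovLaw P := by
  rcases t with _ | n
  · have h1 : ∀ x, F x = F (Function.update (fun _ => 0) 0 (x 0)) := fun x =>
      hF fun i hi => by
        obtain rfl : i = 0 := by simpa using hi
        simp
    have h2 : ∀ x a, stepProb P 0 x a * F (Function.update x 0 a)
        = stepProb P 0 (fun _ => 0) a * F (Function.update (fun _ => 0) 0 a) := fun x a => by
      rw [stepProb_congr P (x := x) (y := fun _ => 0) (by simp), h1]
      simp
    simp_rw [h2]
    rw [integral_congr_ae (ae_of_all _ h1),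
      integral_markovLaw_zero P fun a => F (Function.update (fun _ => 0) 0 a)]
    simp
  · let g : (Finset.Iic n → Fin 2) × Fin 2 → ℝ := fun q =>
      F (Function.update (extendHistory q.1) (n + 1) q.2)
    have hext : ∀ (x : ℕ → Fin 2) i, i < n + 1 →
        extendHistory (Preorder.frestrictLe n x : Finset.Iic n → Fin 2) i = x i := fun x i hi => by
      simp [extendHistory, Nat.lt_succ_iff.1 hi]
    have h1 : ∀ x, F x = g (Preorder.frestrictLe n x, x (n + 1)) := fun x => hF fun i hi => by
      rcases eq_or_ne i (n + 1) with rfl | h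
      · simp
      · have hi : i < n + 1 + 1 := hi
        rw [Function.update_of_ne h, hext x i (by omega)]
    have h2 : ∀ x, ∑ a, stepProb P (n + 1) x a * F (Function.update x (n + 1) a)
        = ∫ a, g (Preorder.frestrictLe n x, a) ∂stepKernel P n (Preorder.frestrictLe n x) :=
        fun x => by
      change _ = ∫ a, _ ∂nextLaw P (n + 1) (extendHistory (Preorder.frestrictLe n x))
      rw [integral_nextLaw]
      refine Finset.sum_congr rfl fun a _ => ?_
      rw [stepProb_congr P (fun i hi => (hext x i hi).symm), h1]
      congr 2
      simp only [Function.update_self, Prod.mk.injEq, and_true]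
      funext i
      have : (i : ℕ) ≤ n := Finset.mem_Iic.1 i.2
      exact Function.update_of_ne (by omega) _ _
    rw [integral_congr_ae (ae_of_all _ h1), integral_congr_ae (ae_of_all _ h2)]
    -- The joint law of the history and the next symbol is the history law composed with the step
    -- kernel.
    have hm := Kernel.map_frestrictLe_trajMeasure_compProd_eq_map_trajMeasure
      (X := fun _ => Fin 2) (μ₀ := nextLaw P 0 fun _ => 0) (κ := stepKernel P) (a := n)
    change (markovLaw P).map _ ⊗ₘ _ = (markovLaw P).map _ at hm
    have hg : Measurable g := measurable_of_finite g
    rw [← integral_map (μ := markovLaw P)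
      (φ := fun x => (Preorder.frestrictLe (π := fun _ => Fin 2) n x, x (n + 1))) (f := g)
      (by fun_prop) hg.aestronglyMeasurable, ← hm, Measure.integral_compProd Integrable.of_finite,
      integral_map (by fun_prop) (measurable_of_finite _).aestronglyMeasurable]

end Markov

/-! ### Forcing a word -/

section Forcing

variable {k : ℕ} (P : MarkovKernel k) {c : ℝ}

/-- The weight `G` will be an exponential moment in the consistency proof and the indicator of a
prefix in the path construction. -/
lemma mul_integral_le_integral_ite_symbol (hc : ∀ t x a, c ≤ stepProb P t x a)
    {G : (ℕ → Fin 2) → ℝ} {t : ℕ} (hG : DependsOn G (Set.Iio t)) (hG0 : ∀ x, 0 ≤ G x)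
    {f : (ℕ → Fin 2) → Fin 2} (hf : DependsOn f (Set.Iio t)) :
    c * ∫ x, G x ∂markovLaw P ≤ ∫ x, (if x t = f x then G x else 0) ∂markovLaw P := by
  have hdep : DependsOn (fun x => if x t = f x then G x else 0) (Set.Iio (t + 1)) := by
    intro x y hxy
    have h : ∀ i ∈ Set.Iio t, x i = y i := fun i hi => hxy i (Nat.lt_succ_of_lt hi)
    simp only [hG h, hf h, hxy t (Nat.lt_succ_self t)]
  rw [integral_markovLaw_eq_step P hdep, ← integral_const_mul]
  refine integral_mono ((integrable_of_dependsOn hG _).const_mul c)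
    (integrable_of_dependsOn (t := t) (fun x y hxy => ?_) _) fun x => ?_
  · refine Finset.sum_congr rfl fun a _ => ?_
    have h : ∀ i ∈ Set.Iio (t + 1), Function.update x t a i = Function.update y t a i := by
      intro i hi
      rcases eq_or_ne i t with rfl | hne
      · simp
      · have hi : i < t + 1 := hi
        rw [Function.update_of_ne hne, Function.update_of_ne hne, hxy i (by simp; omega)]
    rw [stepProb_congr P hxy]
    exact congrArg _ (hdep h)
  · simp only [apply_update_of_dependsOn hG, apply_update_of_dependsOn hf, Function.update_self,
      mul_ite, mul_zero, Finset.sum_ite_eq', Finset.mem_univ, if_true]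
    exact mul_le_mul_of_nonneg_right (hc t x _) (hG0 x)

/-- Each forced symbol costs a factor `c`. The word may depend on the history, as needed to steer
the model back from whatever state it has reached. -/
lemma pow_mul_integral_le_integral_ite_word (hc0 : 0 ≤ c) (hc : ∀ t x a, c ≤ stepProb P t x a)
    {G : (ℕ → Fin 2) → ℝ} {t : ℕ} (hG : DependsOn G (Set.Iio t)) (hG0 : ∀ x, 0 ≤ G x)
    {w : (ℕ → Fin 2) → ℕ → Fin 2} (hw : DependsOn w (Set.Iio t)) (L : ℕ) :
    c ^ L * ∫ x, G x ∂markovLaw P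
      ≤ ∫ x, (if ∀ i < L, x (t + i) = w x i then G x else 0) ∂markovLaw P := by
  induction L with
  | zero => simp
  | succ L ih =>
    have hdep : DependsOn (fun x => if ∀ i < L, x (t + i) = w x i then G x else 0)
        (Set.Iio (t + L)) := by
      intro x y hxy
      have h : ∀ i ∈ Set.Iio t, x i = y i := fun i hi => hxy i (lt_of_lt_of_le hi (Nat.le_add_right t L))
      have h' : (∀ i < L, x (t + i) = w x i) ↔ ∀ i < L, y (t + i) = w y i := by
        rw [hw h]
        exact forall₂_congr fun i hi => by rw [hxy (t + i) (by simpa using hi)]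
      simp only [hG h, h']
    have hw' : DependsOn (fun x => w x L) (Set.Iio (t + L)) := fun x y hxy => by
      exact congrFun (dependsOn_Iio_mono (Nat.le_add_right t L) hw hxy) L
    calc c ^ (L + 1) * ∫ x, G x ∂markovLaw P = c * (c ^ L * ∫ x, G x ∂markovLaw P) := by ring
      _ ≤ c * ∫ x, (if ∀ i < L, x (t + i) = w x i then G x else 0) ∂markovLaw P :=
        mul_le_mul_of_nonneg_left ih hc0
      _ ≤ _ := mul_integral_le_integral_ite_symbol P hc hdep
        (fun x => by split_ifs; exacts [hG0 x, le_rfl]) hw'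
      _ = _ := by
        refine integral_congr_ae (ae_of_all _ fun x => ?_)
        simp only [Nat.lt_succ_iff_lt_or_eq, or_imp, forall_and, forall_eq, ← ite_and, and_comm]

end Forcing

/-! ### Counts -/

section Counts

variable {k : ℕ}

lemma contextCount_succ (x : ℕ → Fin 2) (t : ℕ) (z : Fin k → Fin 2) :
    contextCount k x (t + 1) z
      = contextCount k x t z + if k ≤ t ∧ context k x t = z then 1 else 0 := by
  unfold contextCount
  by_cases h : k ≤ t
  · rw [Nat.Ico_succ_right_eq_insert_Ico h, Finset.filter_insert]
    split_ifs <;> simp_all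
  · simp [h, Finset.Ico_eq_empty_of_le (show t + 1 ≤ k by omega),
      Finset.Ico_eq_empty_of_le (show t ≤ k by omega)]

lemma transitionCount_succ (x : ℕ → Fin 2) (t : ℕ) (z : Fin k → Fin 2) (a : Fin 2) :
    transitionCount k x (t + 1) z a
      = transitionCount k x t z a + if (k ≤ t ∧ context k x t = z) ∧ x t = a then 1 else 0 := by
  unfold transitionCount
  by_cases h : k ≤ t
  · rw [Nat.Ico_succ_right_eq_insert_Ico h, Finset.filter_insert]
    split_ifs <;> simp_all
  · simp [h, Finset.Ico_eq_empty_of_le (show t + 1 ≤ k by omega),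
      Finset.Ico_eq_empty_of_le (show t ≤ k by omega)]

lemma contextCount_congr {t : ℕ} {x y : ℕ → Fin 2} (hxy : ∀ i < t, x i = y i) :
    contextCount k x t = contextCount k y t := by
  funext z
  unfold contextCount
  congr 1
  refine Finset.filter_congr fun j hj => ?_
  have hj := Finset.mem_Ico.1 hj
  rw [context_congr hj.1 fun i hi => hxy i (hi.trans hj.2)]

lemma transitionCount_congr {t : ℕ} {x y : ℕ → Fin 2} (hxy : ∀ i < t, x i = y i) :
    transitionCount k x t = transitionCount k y t := by
  funext z a
  unfold transitionCount
  congr 1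
  refine Finset.filter_congr fun j hj => ?_
  have hj := Finset.mem_Ico.1 hj
  rw [context_congr hj.1 fun i hi => hxy i (hi.trans hj.2), hxy j hj.2]

lemma transitionCount_zero_add_one (x : ℕ → Fin 2) (t : ℕ) (z : Fin k → Fin 2) :
    transitionCount k x t z 0 + transitionCount k x t z 1 = contextCount k x t z := by
  induction t with
  | zero => simp [transitionCount, contextCount]
  | succ t ih =>
    rw [transitionCount_succ, transitionCount_succ, contextCount_succ, ← ih]
    have : x t = 0 ∨ x t = 1 := by omega
    rcases this with h | h <;> split_ifs <;> simp_all <;> omega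

lemma addOne_congr {t : ℕ} (h : k ≤ t) {x y : ℕ → Fin 2} (hxy : ∀ i < t, x i = y i) :
    addOne k x t = addOne k y t := by
  funext a
  unfold addOne
  rw [context_congr h hxy, contextCount_congr hxy, transitionCount_congr hxy]

lemma addOne_zero_add_one (x : ℕ → Fin 2) (t : ℕ) : addOne k x t 0 + addOne k x t 1 = 1 := by
  unfold addOne
  rw [← add_div, div_eq_one_iff_eq (by positivity), ← transitionCount_zero_add_one]
  push_cast
  ring

end Counts

/-! ### Consistency of the add-one estimator -/

section Consistency

variable {k : ℕ} (P : MarkovKernel k)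

/-- The excess of the smoothed number of transitions from `z` to `a` over the proportion `q` of
the smoothed number of visits to `z`. -/
def excess (q : ℝ) (z : Fin k → Fin 2) (a : Fin 2) (x : ℕ → Fin 2) (t : ℕ) : ℝ :=
  (transitionCount k x t z a + 1) - q * (contextCount k x t z + 2)

lemma excess_congr {q : ℝ} {z : Fin k → Fin 2} {a : Fin 2} {t : ℕ} {x y : ℕ → Fin 2}
    (hxy : ∀ i < t, x i = y i) : excess q z a x t = excess q z a y t := by
  unfold excess
  rw [contextCount_congr hxy, transitionCount_congr hxy]

lemma excess_succ (q : ℝ) (z : Fin k → Fin 2) (a : Fin 2) (x : ℕ → Fin 2) (t : ℕ) :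
    excess q z a x (t + 1) = excess q z a x t
      + if k ≤ t ∧ context k x t = z then (if x t = a then 1 else 0) - q else 0 := by
  unfold excess
  rw [transitionCount_succ, contextCount_succ]
  split_ifs <;> simp_all <;> ring

lemma excess_sub_le (q : ℝ) (hq0 : 0 ≤ q) (z : Fin k → Fin 2) (a : Fin 2) (x : ℕ → Fin 2)
    (t n : ℕ) : excess q z a x t - q * n ≤ excess q z a x (t + n) := by
  induction n with
  | zero => simp
  | succ n ih =>
    rw [← add_assoc, excess_succ]
    push_cast
    split_ifs <;> linarith

/-- By `|exp u - 1 - u| ≤ u ^ 2` on `[-1, 1]`: the linear terms cancel, and the quadratic ones sum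
to `l ^ 2 * p * (1 - p)`. -/
lemma bernoulli_mgf_le {p l : ℝ} (hp0 : 0 ≤ p) (hp1 : p ≤ 1) (hl0 : 0 ≤ l) (hl1 : l ≤ 1) :
    p * Real.exp (l * (1 - p)) + (1 - p) * Real.exp (l * (-p)) ≤ Real.exp (l ^ 2) := by
  have h1 := abs_le.1 (Real.abs_exp_sub_one_sub_id_le (x := l * (1 - p))
    (abs_le.2 ⟨by nlinarith, by nlinarith⟩))
  have h2 := abs_le.1 (Real.abs_exp_sub_one_sub_id_le (x := l * (-p))
    (abs_le.2 ⟨by nlinarith, by nlinarith⟩))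
  have h3 := Real.add_one_le_exp (l ^ 2)
  have h4 : p * (1 - p) ≤ 1 := by nlinarith
  have h5 := mul_le_mul_of_nonneg_left h1.2 hp0
  have h6 := mul_le_mul_of_nonneg_left h2.2 (sub_nonneg.2 hp1)
  have h7 : l ^ 2 * (p * (1 - p)) ≤ l ^ 2 * 1 := mul_le_mul_of_nonneg_left h4 (sq_nonneg l)
  linear_combination h5 + h6 + h7 + h3

/-- The rate `l = δ / 2` minimizes the exponent `l ^ 2 - l * δ`, with value `-(δ ^ 2 / 4)`. -/
lemma sum_exp_excess_step_le {δ : ℝ} (hδ0 : 0 < δ) (hδ1 : δ ≤ 1) (q : BinDist) (a : Fin 2) :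
    ∑ b, (q : Fin 2 → ℝ) b *
        Real.exp (δ / 2 * ((if b = a then 1 else 0) - ((q : Fin 2 → ℝ) a + δ)))
      ≤ Real.exp (-(δ ^ 2 / 4)) := by
  have key : ∀ p : ℝ, 0 ≤ p → p ≤ 1 → p * Real.exp (δ / 2 * (1 - (p + δ)))
      + (1 - p) * Real.exp (δ / 2 * (0 - (p + δ))) ≤ Real.exp (-(δ ^ 2 / 4)) := by
    intro p hp0 hp1
    have h := mul_le_mul_of_nonneg_right
      (bernoulli_mgf_le hp0 hp1 (l := δ / 2) (by linarith) (by linarith))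
      (Real.exp_pos (-(δ ^ 2 / 2))).le
    rw [add_mul, mul_assoc, mul_assoc, ← Real.exp_add, ← Real.exp_add, ← Real.exp_add] at h
    rwa [show δ / 2 * (1 - p) + -(δ ^ 2 / 2) = δ / 2 * (1 - (p + δ)) by ring,
      show δ / 2 * -p + -(δ ^ 2 / 2) = δ / 2 * (0 - (p + δ)) by ring,
      show (δ / 2) ^ 2 + -(δ ^ 2 / 2) = -(δ ^ 2 / 4) by ring] at h
  have hs := sum_binDist q
  have h0 : 0 ≤ (q : Fin 2 → ℝ) 0 := q.2.1 0
  have h1 : 0 ≤ (q : Fin 2 → ℝ) 1 := q.2.1 1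
  rw [Fin.sum_univ_two]
  fin_cases a
  · have := key _ h0 (by linarith)
    rw [show 1 - (q : Fin 2 → ℝ) 0 = (q : Fin 2 → ℝ) 1 by linarith] at this
    simpa using this
  · have := key _ h1 (by linarith)
    rw [show 1 - (q : Fin 2 → ℝ) 1 = (q : Fin 2 → ℝ) 0 by linarith] at this
    simpa [add_comm] using this

/-- The exponential moment of the excess over `P z a + δ`. -/
def excessMoment (δ : ℝ) (z : Fin k → Fin 2) (a : Fin 2) (t : ℕ) : ℝ :=
  ∫ x, Real.exp (δ / 2 * excess ((P z : Fin 2 → ℝ) a + δ) z a x t) ∂markovLaw P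

lemma dependsOn_exp_excess (δ q : ℝ) (z : Fin k → Fin 2) (a : Fin 2) (t : ℕ) :
    DependsOn (fun x => Real.exp (δ / 2 * excess q z a x t)) (Set.Iio t) :=
  fun x y hxy => by simp only [excess_congr (q := q) (z := z) (a := a) hxy]

/-- The exponential of the excess is a supermartingale: unchanged off visits to `z`, and shrunk in
conditional mean by at least `exp (-(δ ^ 2 / 4))` at each visit. -/
lemma excessMoment_succ_le {δ : ℝ} (hδ0 : 0 < δ) (hδ1 : δ ≤ 1) (z : Fin k → Fin 2) (a : Fin 2)
    (t : ℕ) :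
    excessMoment P δ z a (t + 1) + (1 - Real.exp (-(δ ^ 2 / 4))) *
        ∫ x, (if k ≤ t ∧ context k x t = z then
          Real.exp (δ / 2 * excess ((P z : Fin 2 → ℝ) a + δ) z a x t) else 0) ∂markovLaw P
      ≤ excessMoment P δ z a t := by
  set q := (P z : Fin 2 → ℝ) a + δ with hq
  have hV := dependsOn_exp_excess δ q z a t
  have hV' := dependsOn_exp_excess δ q z a (t + 1)
  have hvisit : DependsOn (fun x => if k ≤ t ∧ context k x t = z then
      Real.exp (δ / 2 * excess q z a x t) else 0) (Set.Iio t) := fun x y hxy => by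
    by_cases h : k ≤ t
    · simp only [h, context_congr h hxy, excess_congr (q := q) (z := z) (a := a) hxy]
    · simp [h]
  have hstep : ∀ x b, Real.exp (δ / 2 * excess q z a (Function.update x t b) (t + 1))
      = Real.exp (δ / 2 * excess q z a x t) * if k ≤ t ∧ context k x t = z then
        Real.exp (δ / 2 * ((if b = a then 1 else 0) - q)) else 1 := fun x b => by
    have hu : ∀ i < t, Function.update x t b i = x i := fun i hi =>
      Function.update_of_ne hi.ne _ _
    rw [excess_succ, excess_congr hu, Function.update_self]
    by_cases h : k ≤ t
    · rw [context_congr h hu, mul_add, Real.exp_add]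
      split_ifs <;> simp
    · simp [h]
  unfold excessMoment
  rw [← hq, integral_markovLaw_eq_step P hV', ← integral_const_mul,
    ← integral_add (integrable_of_dependsOn (t := t) (fun x y hxy => ?_) _)
      ((integrable_of_dependsOn hvisit _).const_mul _)]
  · refine integral_mono_of_nonneg (ae_of_all _ fun x => ?_) (integrable_of_dependsOn hV _)
      (ae_of_all _ fun x => ?_)
    · refine add_nonneg (Finset.sum_nonneg fun b _ =>
        mul_nonneg (stepProb_nonneg P t x b) (Real.exp_pos _).le) (mul_nonneg ?_ ?_)
      · rw [sub_nonneg, Real.exp_le_one_iff]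
        have := sq_nonneg δ
        linarith
      · split_ifs
        exacts [(Real.exp_pos _).le, le_rfl]
    · simp only [hstep]
      by_cases h : k ≤ t ∧ context k x t = z
      · have hp : ∀ b, stepProb P t x b = (P z : Fin 2 → ℝ) b := fun b => by
          simp [stepProb, h.1, h.2]
        simp only [h, and_self, if_true, hp]
        have := mul_le_mul_of_nonneg_left (sum_exp_excess_step_le hδ0 hδ1 (P z) a)
          (Real.exp_pos (δ / 2 * excess q z a x t)).le
        rw [Finset.mul_sum] at this
        simp only [mul_left_comm (Real.exp (δ / 2 * excess q z a x t)), ← hq] at this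
        linear_combination this
      · simp only [h, if_false, mul_one, mul_zero, add_zero, ← Finset.sum_mul, sum_stepProb,
          one_mul, le_refl]
  · refine Finset.sum_congr rfl fun b _ => ?_
    rw [hstep, hstep, stepProb_congr P hxy, excess_congr hxy]
    by_cases h : k ≤ t
    · rw [context_congr h hxy]
    · simp [h]

lemma excessMoment_nonneg (δ : ℝ) (z : Fin k → Fin 2) (a : Fin 2) (t : ℕ) :
    0 ≤ excessMoment P δ z a t :=
  integral_nonneg fun _ => (Real.exp_pos _).le

lemma antitone_excessMoment {δ : ℝ} (hδ0 : 0 < δ) (hδ1 : δ ≤ 1) (z : Fin k → Fin 2)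
    (a : Fin 2) : Antitone (excessMoment P δ z a) := by
  refine antitone_nat_of_succ_le fun t => le_trans (le_add_of_nonneg_right ?_)
    (excessMoment_succ_le P hδ0 hδ1 z a t)
  refine mul_nonneg ?_ (integral_nonneg fun x => ?_)
  · rw [sub_nonneg, Real.exp_le_one_iff]
    have := sq_nonneg δ
    linarith
  · dsimp only
    split_ifs
    exacts [(Real.exp_pos _).le, le_rfl]

/-- Spelling `z` after time `t` costs a factor `c ^ k` and forces a visit at time `t + k`. Meanwhile
the excess drops by at most `2 * k`, its exponential by at most `exp (-(δ * k))`. -/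
lemma excessMoment_block_le {c : ℝ} (hc0 : 0 < c) (hc : ∀ t x a, c ≤ stepProb P t x a)
    {δ : ℝ} (hδ0 : 0 < δ) (hδ1 : δ ≤ 1) (z : Fin k → Fin 2) (a : Fin 2) (t : ℕ) :
    excessMoment P δ z a (t + k + 1) + (1 - Real.exp (-(δ ^ 2 / 4))) *
        (Real.exp (-(δ * k)) * (c ^ k * excessMoment P δ z a t))
      ≤ excessMoment P δ z a (t + k) := by
  refine le_trans ?_ (excessMoment_succ_le P hδ0 hδ1 z a (t + k))
  set q := (P z : Fin 2 → ℝ) a + δ with hq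
  have hq0 : 0 ≤ q := add_nonneg ((P z).2.1 a) hδ0.le
  have hq2 : q ≤ 2 := by
    have : (P z : Fin 2 → ℝ) a ≤ 1 := (mem_Icc_of_mem_stdSimplex (P z).2 a).2
    linarith
  have hρ : 0 ≤ 1 - Real.exp (-(δ ^ 2 / 4)) := by
    rw [sub_nonneg, Real.exp_le_one_iff]
    have := sq_nonneg δ
    linarith
  refine add_le_add le_rfl (mul_le_mul_of_nonneg_left ?_ hρ)
  have hforce := pow_mul_integral_le_integral_ite_word P hc0.le hc
    (dependsOn_exp_excess δ q z a t) (fun x => (Real.exp_pos _).le)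
    (w := fun _ i => if h : i < k then z ⟨i, h⟩ else 0) (fun _ _ _ => rfl) k
  refine (mul_le_mul_of_nonneg_left hforce (Real.exp_pos _).le).trans ?_
  rw [← integral_const_mul]
  refine integral_mono_of_nonneg (ae_of_all _ fun x => ?_)
    (integrable_of_dependsOn (t := t + k) (fun x y hxy => ?_) _) (ae_of_all _ fun x => ?_)
  · refine mul_nonneg (Real.exp_pos _).le ?_
    split_ifs
    exacts [(Real.exp_pos _).le, le_rfl]
  · simp only [context_congr (Nat.le_add_left k t) hxy, excess_congr (q := q) (z := z) (a := a) hxy]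
  · dsimp only
    split_ifs with h1 h2 h2
    · rw [← Real.exp_add, Real.exp_le_exp]
      have h3 := mul_le_mul_of_nonneg_left (excess_sub_le q hq0 z a x t k) (half_pos hδ0).le
      have h4 := mul_le_mul_of_nonneg_left
        (mul_le_mul_of_nonneg_right hq2 (Nat.cast_nonneg (α := ℝ) k)) (half_pos hδ0).le
      linarith
    · refine absurd ⟨Nat.le_add_left k t, ?_⟩ h2
      funext j
      have := h1 j j.2
      simp only [j.2, dif_pos] at this
      simpa [context] using this
    · simpa using (Real.exp_pos _).le
    · simp

/-- The moments decrease to a limit `l ≥ 0`; the block inequality gives `l + θ * l ≤ l` with `θ >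
0`. -/
lemma tendsto_excessMoment {c : ℝ} (hc0 : 0 < c) (hc : ∀ t x a, c ≤ stepProb P t x a)
    {δ : ℝ} (hδ0 : 0 < δ) (hδ1 : δ ≤ 1) (z : Fin k → Fin 2) (a : Fin 2) :
    Tendsto (excessMoment P δ z a) atTop (nhds 0) := by
  have hanti := antitone_excessMoment P hδ0 hδ1 z a
  obtain ⟨l, hl⟩ : ∃ l, Tendsto (excessMoment P δ z a) atTop (nhds l) :=
    ⟨_, tendsto_atTop_ciInf hanti ⟨0, by rintro _ ⟨t, rfl⟩; exact excessMoment_nonneg P δ z a t⟩⟩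
  have hl0 : 0 ≤ l := ge_of_tendsto' hl fun t => excessMoment_nonneg P δ z a t
  have hρ : 0 < 1 - Real.exp (-(δ ^ 2 / 4)) := by
    rw [sub_pos, Real.exp_lt_one_iff]
    have := pow_pos hδ0 2
    linarith
  have hlim : l + (1 - Real.exp (-(δ ^ 2 / 4))) * (Real.exp (-(δ * k)) * (c ^ k * l)) ≤ l := by
    refine le_of_tendsto_of_tendsto' (b := atTop) (Tendsto.add ?_ ?_) ?_
      fun t => excessMoment_block_le P hc0 hc hδ0 hδ1 z a t
    · exact hl.comp (tendsto_add_atTop_nat (k + 1))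
    · exact ((hl.const_mul _).const_mul _).const_mul _
    · exact hl.comp (tendsto_add_atTop_nat k)
  have hθ : 0 < (1 - Real.exp (-(δ ^ 2 / 4))) * (Real.exp (-(δ * k)) * c ^ k) := by positivity
  have : l = 0 := by
    refine le_antisymm ?_ hl0
    by_contra! h
    have := mul_pos hθ h
    linarith
  exact this ▸ hl

/-- An overestimate by `δ` means a positive excess at the current context. Markov's inequality and a
union bound over contexts and symbols finish the argument. -/
theorem tendsto_measureReal_addOne {c : ℝ} (hc0 : 0 < c) (hc : ∀ t x a, c ≤ stepProb P t x a)
    {δ : ℝ} (hδ0 : 0 < δ) (hδ1 : δ ≤ 1) :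
    Tendsto (fun t => (markovLaw P).real
      {x | ∃ a, δ < |addOne k x t a - (P (context k x t) : Fin 2 → ℝ) a|}) atTop (nhds 0) := by
  have hsum : Tendsto (fun t => ∑ z, ∑ a, excessMoment P δ z a t) atTop (nhds 0) := by
    have := tendsto_finsetSum Finset.univ fun z (_ : z ∈ Finset.univ) =>
      tendsto_finsetSum Finset.univ fun a (_ : a ∈ Finset.univ) =>
        tendsto_excessMoment P hc0 hc hδ0 hδ1 z a
    simpa using this
  refine squeeze_zero (fun _ => measureReal_nonneg) (fun t => ?_) hsum
  have hsub : {x | ∃ a, δ < |addOne k x t a - (P (context k x t) : Fin 2 → ℝ) a|} ⊆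
      ⋃ z, ⋃ a, {x | 1 ≤ Real.exp (δ / 2 * excess ((P z : Fin 2 → ℝ) a + δ) z a x t)} := by
    rintro x ⟨a, ha⟩
    -- The errors at the two symbols are opposite, so overestimates suffice.
    have hex : ∃ b, δ < addOne k x t b - (P (context k x t) : Fin 2 → ℝ) b := by
      have h1 := addOne_zero_add_one (k := k) x t
      have h2 := sum_binDist (P (context k x t))
      rcases lt_abs.1 ha with h | h
      · exact ⟨a, h⟩
      · fin_cases a
        · refine ⟨1, ?_⟩
          simp only [Fin.zero_eta] at h
          linarith
        · refine ⟨0, ?_⟩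
          simp only [Fin.mk_one] at h
          linarith
    obtain ⟨b, hb⟩ := hex
    refine Set.mem_iUnion.2 ⟨context k x t, Set.mem_iUnion.2 ⟨b, ?_⟩⟩
    refine Real.one_le_exp (mul_nonneg (half_pos hδ0).le ?_)
    have hpos : (0 : ℝ) < contextCount k x t (context k x t) + 2 := by positivity
    have hb' : (P (context k x t) : Fin 2 → ℝ) b + δ < addOne k x t b := by linarith
    unfold addOne at hb'
    rw [lt_div_iff₀ hpos] at hb'
    unfold excess
    linarith
  refine (measureReal_mono hsub).trans ((measureReal_iUnion_fintype_le _).trans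
    (Finset.sum_le_sum fun z _ => (measureReal_iUnion_fintype_le _).trans
      (Finset.sum_le_sum fun a _ => ?_)))
  have := mul_meas_ge_le_integral_of_nonneg (μ := markovLaw P)
    (ae_of_all _ fun x => (Real.exp_pos _).le)
    (integrable_of_dependsOn (dependsOn_exp_excess δ ((P z : Fin 2 → ℝ) a + δ) z a t) _) 1
  simpa [excessMoment] using this

end Consistency

/-! ### Predictions of a recurrent model along forced paths -/

namespace RecurrentModel

variable {d : ℕ} (M : RecurrentModel d)

lemma state_congr_add {x y : ℕ → Fin 2} {t : ℕ} (h : M.state x t = M.state y t) {n : ℕ}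
    (hxy : ∀ i < n, x (t + i) = y (t + i)) : M.state x (t + n) = M.state y (t + n) := by
  induction n with
  | zero => exact h
  | succ n ih =>
    rw [← add_assoc, state, state, ih fun i hi => hxy i (hi.trans n.lt_succ_self),
      hxy n n.lt_succ_self]

lemma state_congr {x y : ℕ → Fin 2} {t : ℕ} (hxy : ∀ i < t, x i = y i) :
    M.state x t = M.state y t := by
  have := M.state_congr_add (x := x) (y := y) (t := 0) rfl (n := t) (by simpa using hxy)
  simpa using this

variable {k : ℕ} {P : MarkovKernel k} {c ε : ℝ}

lemma tendsto_measureReal_exists_not_approx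
    (happ : ∀ᵐ x ∂markovLaw P, ∀ᶠ t in atTop,
      ‖(M.predict x t : Fin 2 → ℝ) - addOne k x t‖ ≤ ε) :
    Tendsto (fun t => (markovLaw P).real {x | ∃ n,
      ¬ ‖(M.predict x (t + n) : Fin 2 → ℝ) - addOne k x (t + n)‖ ≤ ε}) atTop (nhds 0) := by
  -- Before time `k` the truncated subtraction in `context` may read symbols at positions `≥ t`; the
  -- shift avoids this.
  rw [← tendsto_add_atTop_iff_nat k]
  set s : ℕ → Set (ℕ → Fin 2) := fun t => {x | ∃ n,
      ¬ ‖(M.predict x (t + k + n) : Fin 2 → ℝ) - addOne k x (t + k + n)‖ ≤ ε}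
  have hmeas : ∀ t, MeasurableSet (s t) := fun t => by
    refine measurableSet_setOfPred.2 (Measurable.exists fun n => ?_)
    refine measurable_of_dependsOn (t := t + k + n) fun x y hxy => ?_
    simp only [predict, M.state_congr hxy,
      addOne_congr (show k ≤ t + k + n by omega) hxy]
  have hanti : Antitone s := by
    rintro a b hab x ⟨n, hn⟩
    refine ⟨b - a + n, ?_⟩
    rwa [show a + k + (b - a + n) = b + k + n by omega]
  have hzero : markovLaw P (⋂ t, s t) = 0 := by
    refine measure_mono_null (fun x hx => ?_) happ
    simp only [Set.mem_iInter] at hx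
    intro hev
    obtain ⟨T, hT⟩ := eventually_atTop.1 hev
    obtain ⟨n, hn⟩ := hx T
    exact hn (hT _ (by omega))
  have := tendsto_measure_iInter_atTop (fun t => (hmeas t).nullMeasurableSet) hanti
    ⟨0, measure_ne_top (markovLaw P) _⟩
  rw [hzero] at this
  exact (ENNReal.tendsto_toReal ENNReal.zero_ne_top).comp this

/-- Along some path with a prescribed beginning, and with a continuation prescribed in terms of
the history, the predictions are close to the transition probabilities. -/
theorem eventually_exists_path (hc0 : 0 < c) (hc : ∀ t x a, c ≤ stepProb P t x a)
    (happ : ∀ᵐ x ∂markovLaw P, ∀ᶠ t in atTop,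
      ‖(M.predict x t : Fin 2 → ℝ) - addOne k x t‖ ≤ ε)
    {δ : ℝ} (hδ0 : 0 < δ) (hδ1 : δ ≤ 1) (m L : ℕ) (u : ℕ → Fin 2) :
    ∀ᶠ t in atTop, ∀ w : (ℕ → Fin 2) → ℕ → Fin 2, DependsOn w (Set.Iio t) →
      ∃ x, (∀ i < m, x i = u i) ∧ (∀ i < L, x (t + i) = w x i) ∧
        ∀ n ≤ L, ∀ a, |(M.predict x (t + n) : Fin 2 → ℝ) a
          - (P (context k x (t + n)) : Fin 2 → ℝ) a| ≤ ε + δ := by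
  have hlim := (M.tendsto_measureReal_exists_not_approx happ).add
    (tendsto_finsetSum (Finset.range (L + 1)) fun n _ =>
      (tendsto_measureReal_addOne P hc0 hc hδ0 hδ1).comp (tendsto_add_atTop_nat n))
  simp only [Finset.sum_const_zero, add_zero] at hlim
  -- Prefix and word together have probability at least `c ^ L * c ^ m`, eventually more than the
  -- total probability of failure, so some such path is good.
  filter_upwards [hlim.eventually_lt_const (show 0 < c ^ L * c ^ m by positivity),
    eventually_ge_atTop m] with t ht hmt w hw
  by_contra! hno
  refine absurd ht (not_lt.2 ?_)
  have hprefix := pow_mul_integral_le_integral_ite_word P hc0.le hc (G := fun _ => 1) (t := 0)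
    (fun _ _ _ => rfl) (fun _ => zero_le_one) (w := fun _ => u) (fun _ _ _ => rfl) m
  have hdep : DependsOn (fun x : ℕ → Fin 2 => if ∀ i < m, x i = u i then (1 : ℝ) else 0)
      (Set.Iio t) := fun x y hxy => by
    have : (∀ i < m, x i = u i) ↔ ∀ i < m, y i = u i :=
      forall₂_congr fun i hi => by rw [hxy i (hi.trans_le hmt)]
    simp only [this]
  have hword := pow_mul_integral_le_integral_ite_word P hc0.le hc hdep
    (fun x => by split_ifs <;> norm_num) hw L
  simp only [integral_const, probReal_univ, smul_eq_mul, mul_one, zero_add] at hprefix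
  have hind : ∫ x, (if ∀ i < L, x (t + i) = w x i then
        (if ∀ i < m, x i = u i then (1 : ℝ) else 0) else 0) ∂markovLaw P
      = (markovLaw P).real {x | (∀ i < L, x (t + i) = w x i) ∧ ∀ i < m, x i = u i} := by
    rw [← integral_indicator_one]
    · refine integral_congr_ae (ae_of_all _ fun x => ?_)
      simp only [← ite_and, Set.indicator_apply, Set.mem_ofPred_eq, Pi.one_apply]
    · refine measurableSet_of_dependsOn (t := t + L) fun x y hxy => ?_
      have hw' := dependsOn_Iio_mono (Nat.le_add_right t L) hw hxy
      rw [hw']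
      refine propext (and_congr (forall₂_congr fun i hi => ?_) (forall₂_congr fun i hi => ?_))
      · rw [hxy (t + i) (by simpa using hi)]
      · rw [hxy i (by simp; omega)]
  refine (mul_le_mul_of_nonneg_left hprefix (by positivity)).trans (hword.trans ?_)
  rw [hind]
  have hsub : {x | (∀ i < L, x (t + i) = w x i) ∧ ∀ i < m, x i = u i} ⊆
      {x | ∃ n, ¬ ‖(M.predict x (t + n) : Fin 2 → ℝ) - addOne k x (t + n)‖ ≤ ε} ∪
        ⋃ n ∈ Finset.range (L + 1), {x | ∃ a,
          δ < |addOne k x (t + n) a - (P (context k x (t + n)) : Fin 2 → ℝ) a|} := by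
    rintro x ⟨hx1, hx2⟩
    obtain ⟨n, hn, a, ha⟩ := hno x hx2 hx1
    by_contra hx
    simp only [Set.mem_union, Set.mem_iUnion, Set.mem_ofPred_eq, not_or, not_exists, not_not,
      not_lt, Finset.mem_range] at hx
    have h1 := (norm_le_pi_norm _ a).trans (hx.1 n)
    have h2 := hx.2 n (by omega) a
    rw [Pi.sub_apply, Real.norm_eq_abs] at h1
    have := abs_sub_le ((M.predict x (t + n) : Fin 2 → ℝ) a) (addOne k x (t + n) a)
      ((P (context k x (t + n)) : Fin 2 → ℝ) a)
    linarith
  exact (measureReal_mono hsub).trans ((measureReal_union_le _ _).trans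
    (add_le_add le_rfl (measureReal_biUnion_finset_le _ _)))

end RecurrentModel

/-! ### The prior -/

section Prior

lemma measurable_binDist_coord (a : Fin 2) : Measurable fun q : BinDist => (q : Fin 2 → ℝ) a :=
  (measurable_pi_apply a).comp measurable_subtype_coe

lemma dirichletOne_coord_le (y r : ℝ) :
    dirichletOne {q | |(q : Fin 2 → ℝ) 1 - y| ≤ r} ≤ ENNReal.ofReal (2 * r) := by
  have hmeas : MeasurableSet {q : BinDist | |(q : Fin 2 → ℝ) 1 - y| ≤ r} :=
    measurableSet_le ((measurable_binDist_coord 1).sub_const y).abs measurable_const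
  rw [dirichletOne, Measure.map_apply stdSimplexHomeomorphUnitInterval.symm.continuous.measurable
    hmeas, unitInterval.volume_apply]
  refine (measure_mono (t := Set.Icc (y - r) (y + r)) ?_).trans_eq ?_
  · rintro _ ⟨u, hu, rfl⟩
    have hu : |(u : ℝ) - y| ≤ r := hu
    rw [abs_le] at hu
    constructor <;> linarith
  · rw [Real.volume_Icc]
    congr 1
    ring

instance (k : ℕ) : IsProbabilityMeasure (kernelPrior k) := by
  unfold kernelPrior; infer_instance

lemma dirichletOne_ae_pos : ∀ᵐ q : BinDist ∂dirichletOne, ∀ a, 0 < (q : Fin 2 → ℝ) a := by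
  have hmeas : Measurable (stdSimplexHomeomorphUnitInterval.symm) :=
    stdSimplexHomeomorphUnitInterval.symm.continuous.measurable
  rw [ae_all_iff]
  intro a
  rw [dirichletOne, ae_map_iff hmeas.aemeasurable (measurableSet_lt measurable_const
    (measurable_binDist_coord a))]
  filter_upwards [compl_mem_ae_iff.2 (measure_singleton (0 : unitInterval)),
    compl_mem_ae_iff.2 (measure_singleton (1 : unitInterval))] with u h0 h1
  fin_cases a
  · exact sub_pos.2 (unitInterval.lt_one_iff_ne_one.2 h1)
  · exact unitInterval.pos_iff_ne_zero.2 h0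

lemma kernelPrior_ae_pos (k : ℕ) :
    ∀ᵐ P ∂kernelPrior k, ∀ z a, 0 < (P z : Fin 2 → ℝ) a := by
  rw [ae_all_iff]
  intro z
  exact (Measure.quasiMeasurePreserving_eval
    (μ := fun _ : Fin k → Fin 2 => dirichletOne) z).ae dirichletOne_ae_pos

lemma exists_pos_le_stepProb {k : ℕ} {P : MarkovKernel k} (hP : ∀ z a, 0 < (P z : Fin 2 → ℝ) a) :
    ∃ c > 0, ∀ t x a, c ≤ stepProb P t x a := by
  obtain ⟨q, hq⟩ := Finite.exists_min fun q : (Fin k → Fin 2) × Fin 2 => (P q.1 : Fin 2 → ℝ) q.2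
  -- The value `1 / 2` accounts for the uniform symbols before time `k`.
  refine ⟨min ((P q.1 : Fin 2 → ℝ) q.2) (1 / 2), lt_min (hP _ _) (by norm_num), fun t x a => ?_⟩
  unfold stepProb
  split_ifs
  · exact (min_le_left _ _).trans (hq (_, a))
  · exact min_le_right _ _

lemma kernelPrior_box_le {k : ℕ} (y : (Fin k → Fin 2) → ℝ) (r : ℝ) :
    kernelPrior k {P | ∀ z, |(P z : Fin 2 → ℝ) 1 - y z| ≤ r} ≤ ENNReal.ofReal (2 * r) ^ 2 ^ k := by
  have : {P : MarkovKernel k | ∀ z, |(P z : Fin 2 → ℝ) 1 - y z| ≤ r}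
      = Set.univ.pi fun z => {q : BinDist | |(q : Fin 2 → ℝ) 1 - y z| ≤ r} := by
    ext P; simp
  rw [this, kernelPrior, Measure.pi_pi]
  refine (Finset.prod_le_prod' fun z _ => dirichletOne_coord_le (y z) r).trans ?_
  simp

/-- If almost every kernel is eventually within `r` of one of `N` centers, then the `N` boxes of
radius `r` have total volume at least one. -/
theorem one_le_card_mul_pow {k N : ℕ} {r : ℝ} (hr : 0 ≤ r)
    (C : ℕ → Finset ((Fin k → Fin 2) → ℝ)) (hC : ∀ t, (C t).card ≤ N)
    (h : ∀ᵐ P ∂kernelPrior k, ∀ᶠ t in atTop, ∃ y ∈ C t, ∀ z,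
      |(P z : Fin 2 → ℝ) 1 - y z| ≤ r) :
    1 ≤ N * (2 * r) ^ 2 ^ k := by
  -- These sets increase to a set of full measure, and each `A T` is covered by the boxes at time
  -- `T` alone.
  set A : ℕ → Set (MarkovKernel k) := fun T =>
    {P | ∀ t ≥ T, ∃ y ∈ C t, ∀ z, |(P z : Fin 2 → ℝ) 1 - y z| ≤ r}
  have hA : Monotone A := fun S T hST P hP t ht => hP t (le_trans hST ht)
  have hle : ∀ T, kernelPrior k (A T) ≤ N * ENNReal.ofReal (2 * r) ^ 2 ^ k := fun T => by
    have hsub : A T ⊆ ⋃ y ∈ C T, {P | ∀ z, |(P z : Fin 2 → ℝ) 1 - y z| ≤ r} := fun P hP => by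
      obtain ⟨y, hy, hz⟩ := hP T le_rfl
      exact Set.mem_biUnion hy hz
    refine (measure_mono hsub).trans ((measure_biUnion_finset_le _ _).trans
      ((Finset.sum_le_card_nsmul _ _ _ fun y _ => kernelPrior_box_le y r).trans ?_))
    rw [nsmul_eq_mul]
    gcongr
    exact hC T
  have huniv : kernelPrior k (⋃ T, A T) = 1 := by
    rw [← measure_univ (μ := kernelPrior k)]
    refine measure_congr (eventuallyEq_univ.2 ?_)
    filter_upwards [h] with P hP
    exact Set.mem_iUnion.2 (eventually_atTop.1 hP)
  have hlim := le_of_tendsto' (tendsto_measure_iUnion_atTop (μ := kernelPrior k) hA) hle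
  rw [huniv, ← ENNReal.ofReal_pow (by positivity), ← ENNReal.ofReal_natCast,
    ← ENNReal.ofReal_mul (by positivity), ENNReal.one_le_ofReal] at hlim
  exact hlim

/-- The centers may depend on the slack `δ`, but their number is bounded uniformly, so `δ` can tend
to zero. -/
theorem one_le_card_mul_pow_of_forall {k N : ℕ} {ε : ℝ} (hε : 0 ≤ ε)
    (h : ∀ δ : ℝ, 0 < δ → δ ≤ 1 → ∃ C : ℕ → Finset ((Fin k → Fin 2) → ℝ),
      (∀ t, (C t).card ≤ N) ∧ ∀ᵐ P ∂kernelPrior k, ∀ᶠ t in atTop, ∃ y ∈ C t, ∀ z,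
        |(P z : Fin 2 → ℝ) 1 - y z| ≤ ε + δ) :
    1 ≤ N * (2 * ε) ^ 2 ^ k := by
  have hlim : Tendsto (fun δ : ℝ => (N : ℝ) * (2 * (ε + δ)) ^ 2 ^ k) (nhdsWithin 0 (Set.Ioi 0))
      (nhds (N * (2 * (ε + 0)) ^ 2 ^ k)) :=
    (Continuous.tendsto (by fun_prop) 0).mono_left nhdsWithin_le_nhds
  rw [add_zero] at hlim
  refine ge_of_tendsto hlim ?_
  filter_upwards [Ioc_mem_nhdsGT (zero_lt_one (α := ℝ))] with δ hδ
  obtain ⟨C, hC, hae⟩ := h δ hδ.1 hδ.2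
  exact one_le_card_mul_pow (add_nonneg hε hδ.1.le) C hC hae

end Prior

/-! ### Counting states -/

/-- All contexts are concatenated, `z` being block number `e z`. If `k = 0`, the length is zero. -/
lemma exists_word_visiting_all (k : ℕ) :
    ∃ (w : ℕ → Fin 2) (L : ℕ) (pos : (Fin k → Fin 2) → ℕ),
      ∀ z, pos z + k ≤ L ∧ ∀ j : Fin k, w (pos z + j) = z j := by
  let e := Fintype.equivFin (Fin k → Fin 2)
  refine ⟨fun i => if h : i / k < Fintype.card (Fin k → Fin 2) ∧ 0 < k then
      e.symm ⟨i / k, h.1⟩ ⟨i % k, Nat.mod_lt _ h.2⟩ else 0,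
    k * Fintype.card (Fin k → Fin 2), fun z => k * e z, fun z => ⟨?_, fun j => ?_⟩⟩
  · rw [← Nat.mul_succ]
    exact Nat.mul_le_mul_left k (e z).2
  · have hk : 0 < k := j.pos
    have h1 : (k * (e z : ℕ) + j) / k = e z := by
      rw [Nat.mul_add_div hk, Nat.div_eq_of_lt j.2, add_zero]
    have h2 : (k * (e z : ℕ) + j) % k = j := by
      rw [Nat.mul_add_mod, Nat.mod_eq_of_lt j.2]
    simp only [h1, h2, hk, (e z).2, and_self, dif_pos, Fin.eta, Equiv.symm_apply_apply]

lemma context_add_of_forall {k : ℕ} {x : ℕ → Fin 2} {t : ℕ} {z : Fin k → Fin 2}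
    (h : ∀ j : Fin k, x (t + j) = z j) : context k x (t + k) = z := by
  funext j
  simpa [context] using h j

namespace RecurrentModel

variable {k d p : ℕ} {ε : ℝ} {M : RecurrentModel d}

/-- Almost every kernel allows to choose paths along which the model predicts well. -/
lemma ApproximatesAddOne.ae_eventually_exists_path (h : M.ApproximatesAddOne k ε) {δ : ℝ}
    (hδ0 : 0 < δ) (hδ1 : δ ≤ 1) :
    ∀ᵐ P ∂kernelPrior k, ∀ (m L : ℕ) (u : ℕ → Fin 2),
      ∀ᶠ t in atTop, ∀ w : (ℕ → Fin 2) → ℕ → Fin 2, DependsOn w (Set.Iio t) →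
        ∃ x, (∀ i < m, x i = u i) ∧ (∀ i < L, x (t + i) = w x i) ∧
          ∀ n ≤ L, ∀ a, |(M.predict x (t + n) : Fin 2 → ℝ) a
            - (P (context k x (t + n)) : Fin 2 → ℝ) a| ≤ ε + δ := by
  filter_upwards [h, kernelPrior_ae_pos k] with P hP hpos m L u
  obtain ⟨c, hc0, hc⟩ := exists_pos_le_stepProb hpos
  exact M.eventually_exists_path hc0 hc hP hδ0 hδ1 m L u

lemma HasBitPrecision.exists_finset_state (hp : M.HasBitPrecision p) :
    ∃ S : Finset (Fin d → ℝ), S.card ≤ 2 ^ (d * p) ∧ ∀ x t, M.state x t ∈ S := by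
  obtain ⟨F, hF, hmem⟩ := hp
  refine ⟨Fintype.piFinset F, ?_, fun x t => Fintype.mem_piFinset.2 (hmem x t)⟩
  rw [Fintype.card_piFinset, mul_comm d p, pow_mul]
  refine (Finset.prod_le_prod' fun i _ => hF i).trans ?_
  simp

/-- The states reached at a given time carry enough information to locate almost every kernel. -/
theorem ApproximatesAddOne.one_le_card_mul_pow (h : M.ApproximatesAddOne k ε) (hε0 : 0 < ε)
    {S : Finset (Fin d → ℝ)} (hS : ∀ x t, M.state x t ∈ S) :
    1 ≤ S.card * (2 * ε) ^ 2 ^ k := by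
  classical
  obtain ⟨w, L, pos, hw⟩ := exists_word_visiting_all k
  refine one_le_card_mul_pow_of_forall hε0.le fun δ hδ0 hδ1 => ?_
  -- The path chosen is immaterial: the state `s` and the symbols of `w` fix all later states. The
  -- value `0` is given only to states from which no path reads `w`.
  let center : ℕ → (Fin d → ℝ) → (Fin k → Fin 2) → ℝ := fun t s z =>
    if hs : ∃ x, M.state x t = s ∧ ∀ i < L, x (t + i) = w i then
      (M.predict hs.choose (t + (pos z + k)) : Fin 2 → ℝ) 1 else 0
  refine ⟨fun t => S.image (center t), fun t => Finset.card_image_le, ?_⟩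
  filter_upwards [h.ae_eventually_exists_path hδ0 hδ1] with P hP
  filter_upwards [hP 0 L w] with t ht
  obtain ⟨x, -, hx, hpred⟩ := ht (fun _ => w) fun _ _ _ => rfl
  refine ⟨_, Finset.mem_image_of_mem _ (hS x t), fun z => ?_⟩
  have hs : ∃ x', M.state x' t = M.state x t ∧ ∀ i < L, x' (t + i) = w i := ⟨x, rfl, hx⟩
  have hctx : context k x (t + (pos z + k)) = z := by
    rw [← add_assoc]
    refine context_add_of_forall fun j => ?_
    rw [add_assoc, hx _ (lt_of_lt_of_le (Nat.add_lt_add_left j.2 _) (hw z).1), (hw z).2]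
  have hstate : M.state hs.choose (t + (pos z + k)) = M.state x (t + (pos z + k)) :=
    M.state_congr_add hs.choose_spec.1 fun i hi => by
      have hi' : i < L := hi.trans_le (hw z).1
      rw [hs.choose_spec.2 i hi', hx i hi']
  have := hpred _ (hw z).1 1
  rw [hctx, abs_sub_comm] at this
  simp only [center, dif_pos hs, predict, hstate]
  exact this

end RecurrentModel

/-! ### Time-invariant dynamics -/

section Run

variable {σ : Type*} (f : σ → Fin 2 → σ)

/-- The state of the automaton `f` after it has read `n` symbols of `w` from the state `s`. -/
def run (w : ℕ → Fin 2) (s : σ) : ℕ → σ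
  | 0 => s
  | n + 1 => f (run w s n) (w n)

lemma run_congr {w v : ℕ → Fin 2} (s : σ) {n : ℕ} (h : ∀ i < n, w i = v i) :
    run f w s n = run f v s n := by
  induction n with
  | zero => rfl
  | succ n ih => rw [run, run, ih fun i hi => h i (hi.trans n.lt_succ_self), h n n.lt_succ_self]

/-- The state `s'` can be reached from `s`. -/
def Reaches : σ → σ → Prop :=
  Relation.ReflTransGen fun s s' => ∃ a, f s a = s'

lemma reaches_run (w : ℕ → Fin 2) (s : σ) (n : ℕ) : Reaches f s (run f w s n) := by
  induction n with
  | zero => exact .refl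
  | succ n ih => exact ih.tail ⟨_, rfl⟩

lemma Reaches.exists_run {s s' : σ} (h : Reaches f s s') : ∃ n w, run f w s n = s' := by
  induction h with
  | refl => exact ⟨0, fun _ => 0, rfl⟩
  | tail _ h ih =>
    obtain ⟨n, w, rfl⟩ := ih
    obtain ⟨a, rfl⟩ := h
    refine ⟨n + 1, Function.update w n a, ?_⟩
    rw [run, Function.update_self,
      run_congr f s fun i hi => Function.update_of_ne (ne_of_lt hi) _ _]

/-- A state from which only finitely many states can be reached leads to a recurrent state. -/
lemma exists_recurrent {s : σ} (hs : {s' | Reaches f s s'}.Finite) :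
    ∃ r, Reaches f s r ∧ ∀ s', Reaches f r s' → Reaches f s' r := by
  -- Take `r` with the fewest reachable states: any `s'` reached from `r` then has the same
  -- reachable set, which contains `r`.
  obtain ⟨r, hr, hmin⟩ := hs.exists_minimalFor (fun q => {s' | Reaches f q s'}.ncard) _
    ⟨s, .refl⟩
  refine ⟨r, hr, fun s' hs' => ?_⟩
  have hsub : {q | Reaches f s' q} ⊆ {q | Reaches f r q} := fun q hq => hs'.trans hq
  have hfin : {q | Reaches f r q}.Finite := hs.subset fun q hq => Relation.ReflTransGen.trans hr hq
  have hle := hmin (j := s') (Relation.ReflTransGen.trans hr hs')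
    (Set.ncard_le_ncard hsub hfin)
  have := Set.eq_of_subset_of_ncard_le hsub hle hfin
  exact this.ge (show r ∈ {q | Reaches f r q} from .refl)

end Run

namespace RecurrentModel

variable {k d : ℕ} {ε : ℝ} {M : RecurrentModel d}

lemma TimeInvariant.state_add (hM : M.TimeInvariant) (x : ℕ → Fin 2) (t n : ℕ) :
    M.state x (t + n) = run (M.step 0) (fun i => x (t + i)) (M.state x t) n := by
  induction n with
  | zero => rfl
  | succ n ih => rw [← add_assoc, state, ih, hM.1 _ 0, run]

lemma TimeInvariant.state_eq_run (hM : M.TimeInvariant) (x : ℕ → Fin 2) (n : ℕ) :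
    M.state x n = run (M.step 0) x M.init n := by
  simpa [state] using hM.state_add x 0 n

/-- With finitely many states and time-invariant dynamics, the model returns to one and the same
recurrent state under almost every kernel, so that its predictions there cannot depend on the
kernel and no accuracy better than `1 / 2` is possible. -/
theorem ApproximatesAddOne.half_le_of_timeInvariant (h : M.ApproximatesAddOne k ε)
    (hε0 : 0 < ε) (hM : M.TimeInvariant) {S : Finset (Fin d → ℝ)} (hS : ∀ x t, M.state x t ∈ S) :
    1 / 2 ≤ ε := by
  set f := M.step 0 with hf
  obtain ⟨r, hr, hrec⟩ := exists_recurrent f (s := M.init) (S.finite_toSet.subset fun s hs => by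
    obtain ⟨n, w, rfl⟩ := Reaches.exists_run f hs
    rw [← hM.state_eq_run]
    exact hS w n)
  obtain ⟨m, u, hu⟩ := hr.exists_run
  have hret : ∀ s, ∃ n w, Reaches f r s → run f w s n = r := fun s => by
    by_cases hs : Reaches f r s
    · obtain ⟨n, w, hw⟩ := (hrec s hs).exists_run
      exact ⟨n, w, fun _ => hw⟩
    · exact ⟨0, fun _ => 0, fun h => absurd h hs⟩
  choose N W hW using hret
  let word : (Fin k → Fin 2) → ℕ → Fin 2 := fun z i => if h : i < k then z ⟨i, h⟩ else 0
  -- This center involves neither the kernel nor the time.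
  let y : (Fin k → Fin 2) → ℝ := fun z => (M.readout 0 (run f (word z) r k) : Fin 2 → ℝ) 1
  have hvol : 1 ≤ ((1 : ℕ) : ℝ) * (2 * ε) ^ 2 ^ k := by
    refine one_le_card_mul_pow_of_forall hε0.le fun δ hδ0 hδ1 => ⟨fun _ => {y}, fun _ => by simp, ?_⟩
    filter_upwards [h.ae_eventually_exists_path hδ0 hδ1] with P hP
    refine Eventually.of_forall fun _ => ⟨y, Finset.mem_singleton_self _, fun z => ?_⟩
    -- The prefix `u` leads into the recurrent class of `r`. The continuation first returns to `r`,
    -- in at most `S.sup N` steps, and then spells `z`.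
    obtain ⟨t, ht, hmt⟩ := ((hP m (S.sup N + k) u).and (eventually_ge_atTop m)).exists
    obtain ⟨x, hxu, hxw, hpred⟩ := ht (fun x i => if i < N (M.state x t) then W (M.state x t) i
      else word z (i - N (M.state x t))) fun x x' hxx' => by simp only [M.state_congr hxx']
    set s := M.state x t with hs
    have hNs : N s ≤ S.sup N := Finset.le_sup (hS x t)
    have hsr : Reaches f r s := by
      have h1 : M.state x m = r := by
        rw [hM.state_eq_run, run_congr _ _ hxu, hu]
      have h2 := hM.state_add x m (t - m)
      rw [h1, Nat.add_sub_cancel' hmt] at h2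
      rw [hs, h2]
      exact reaches_run f _ _ _
    have hback : M.state x (t + N s) = r := by
      rw [hM.state_add, ← hs, ← hW s hsr]
      refine run_congr _ _ fun i hi => ?_
      rw [hxw i (by omega), if_pos hi]
    have hxz : ∀ i < k, x (t + N s + i) = word z i := fun i hi => by
      rw [add_assoc, hxw _ (by omega), if_neg (by omega), Nat.add_sub_cancel_left]
    have hctx : context k x (t + N s + k) = z :=
      context_add_of_forall fun j => by
        rw [hxz j j.2]
        simp [word]
    have hstate : M.state x (t + N s + k) = run f (word z) r k := by
      rw [hM.state_add, hback]
      exact run_congr _ _ hxz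
    have := hpred (N s + k) (by omega) 1
    rw [← add_assoc, hctx, abs_sub_comm, predict, hstate, hM.2 _ 0] at this
    exact this
  rw [Nat.cast_one, one_mul] at hvol
  by_contra! hlt
  exact absurd hvol (not_le.2 (pow_lt_one₀ (by linarith) (by linarith) (by positivity)))

end RecurrentModel

/-! ### The numerical inequality -/

/-- With `l = -log ε` the claim is `log 2 ≤ l * (1 - (1 - 3 * ε) * log 2)`. The tangent to the
logarithm at `ε = 1 / 4` gives `l ≥ 1 + 2 * log 2 - 4 * ε`, which leaves a quadratic inequality in
`ε`. -/
lemma one_sub_mul_log_le_logb {ε : ℝ} (hε0 : 0 < ε) (hε1 : ε < 1 / 3) :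
    (1 - 3 * ε) * Real.log (1 / ε) ≤ Real.logb 2 (1 / (2 * ε)) := by
  have hl2 := Real.log_two_lt_d9
  have hl2' := Real.log_two_gt_d9
  have h4 : Real.log (4 * ε) ≤ 4 * ε - 1 := Real.log_le_sub_one_of_pos (by positivity)
  rw [show (4 : ℝ) * ε = 2 * (2 * ε) by ring, Real.log_mul (by norm_num) (by positivity),
    Real.log_mul (by norm_num) hε0.ne'] at h4
  rw [Real.logb, le_div_iff₀ (by linarith), one_div, one_div, Real.log_inv, Real.log_inv,
    Real.log_mul (by norm_num) hε0.ne']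
  set l := -Real.log ε with hl
  have hl0 : 2.386 - 4 * ε ≤ l := by linarith
  have h5 : (2.386 - 4 * ε) * (0.306 + 2 * ε) ≤ l * (1 - (1 - 3 * ε) * Real.log 2) := by
    refine mul_le_mul hl0 ?_ (by linarith) (by linarith)
    nlinarith
  nlinarith

lemma two_pow_mul_le_of_one_le {k n : ℕ} {ε : ℝ} (hε0 : 0 < ε) (hε1 : ε < 1 / 3)
    (h : 1 ≤ (2 : ℝ) ^ n * (2 * ε) ^ 2 ^ k) :
    (2 : ℝ) ^ k * (1 - 3 * ε) * Real.log (1 / ε) ≤ n := by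
  have h1 : Real.logb 2 1 ≤ Real.logb 2 ((2 : ℝ) ^ n * (2 * ε) ^ 2 ^ k) :=
    Real.logb_le_logb_of_le one_lt_two one_pos h
  rw [Real.logb_one, Real.logb_mul (by positivity) (by positivity), Real.logb_pow, Real.logb_pow,
    Real.logb_self_eq_one one_lt_two] at h1
  have h2 := one_sub_mul_log_le_logb hε0 hε1
  rw [one_div (2 * ε), Real.logb_inv] at h2
  have h3 := mul_le_mul_of_nonneg_left h2 (show (0 : ℝ) ≤ 2 ^ k by positivity)
  push_cast at h1
  linarith

end MarkovICL

end

/-! ### The lower bounds on the state size -/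

theorem theorem2 (k d p : ℕ) (ε : ℝ) (hε0 : 0 < ε) (hε1 : ε ≤ 1)
    (M : MarkovICL.RecurrentModel d) (hp : M.HasBitPrecision p)
    (happrox : M.ApproximatesAddOne k ε) :
    (2 : ℝ) ^ k * (1 - 3 * ε) * Real.log (1 / ε) ≤ (d : ℝ) * p ∧
      (M.TimeInvariant →
        (2 : ℝ) ^ k * (1 - 3 * ε) * Real.logb 2 (1 / ε) ≤ (d : ℝ) * p) := by
  obtain ⟨S, hcard, hS⟩ := hp.exists_finset_state
  have hdp : (0 : ℝ) ≤ d * p := by positivity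
  have h1ε : 1 ≤ 1 / ε := (one_le_div hε0).2 hε1
  -- Here `1 - 3 * ε ≤ 0`. This disposes of large `ε` and, since `1 / 2 ≤ ε` there, of the whole
  -- time-invariant case.
  have htriv : ∀ l : ℝ, 1 / 3 ≤ ε → 0 ≤ l → (2 : ℝ) ^ k * (1 - 3 * ε) * l ≤ d * p := by
    intro l hε hl
    refine le_trans ?_ hdp
    exact mul_nonpos_of_nonpos_of_nonneg
      (mul_nonpos_of_nonneg_of_nonpos (by positivity) (by linarith)) hl
  refine ⟨?_, fun hM => ?_⟩
  · rcases le_or_gt (1 / 3) ε with hε | hε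
    · exact htriv _ hε (Real.log_nonneg h1ε)
    · have h := happrox.one_le_card_mul_pow hε0 hS
      have := MarkovICL.two_pow_mul_le_of_one_le (k := k) (n := d * p) hε0 hε
        (h.trans (mul_le_mul_of_nonneg_right (by exact_mod_cast hcard) (by positivity)))
      exact_mod_cast this
  · have := happrox.half_le_of_timeInvariant hε0 hM hS
    exact htriv _ (by linarith) (Real.logb_nonneg one_lt_two h1ε)
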